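/- Let $G$ be a finite connected graph (loops and multiple edges allowed) and let $\mathbb{E}$ be a 2-cell embedding of $G$ in a closed orientable surface, given by its rotation system: a fixed-point-free involution $\alpha$ on the set of half edges that exchanges the two halves of each edge, and a permutation $\beta$ whose cycles are the counterclockwise cyclic orders of the half edges around the vertices. The faces of $\mathbb{E}$ are the cycles of $\gamma=\alpha\beta$ (first apply $\beta$, then $\alpha$); if $G$ is a single vertex without edges, there is exactly one face, and it is incident to that vertex. A face is incident to a vertex $v$ if it contains a half edge of $v$. The genus $g(\mathbb{E})$ is given by $2g(\mathbb{E})=b(G)+1-f$, where $f$ is the number of faces and $b(G)=|E(G)|-|V(G)|+1$. Let $v$ be a vertex of $G$ with set $H(v)$ of half edges, let $\deg(v)=|H(v)|$, and let $q$ be the number of faces incident to $v$. Let $\pi_v$ be the restriction of $\beta$ to $H(v)$, let $s_v$ be the permutation of $H(v)$ obtained from the cycles of $\gamma$ by deleting all half edges not in $H(v)$, and put $D_v=s_v\circ\pi_v^{-1}$. Let $\ell(\lambda(D_v))$ be the number of cycles of $D_v$, fixed points included. Then for every integer $\Delta g$ with $$-\left\lfloor\frac{\deg(v)+1-\ell(\lambda(D_v))-q}{2}\right\rfloor\le\Delta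 g\le\left\lfloor\frac{q-1}{2}\right\rfloor$$ there is an embedding $\mathbb{E}'$ of $G$, obtained from $\mathbb{E}$ by changing only the cyclic order of the half edges around $v$, such that $g(\mathbb{E}')=g(\mathbb{E})+\Delta g$. In particular, if $v$ is incident to every face of $\mathbb{E}$, then $G$ is upper embeddable, that is, the maximum genus of the embeddings of $G$ equals $\lfloor b(G)/2\rfloor$. -/

import Mathlib

/-- A multigraph with vertex type `V` and edge type `E`, loops and multiple edges allowed:
each edge `e` has two ends, labelled by the two elements of `Bool`, and `ends e b` is the vertex
at the end `b` (the labelling is only a way to tell the two ends apart, also for a loop). -/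
structure MultiGraph (V E : Type*) where
  ends : E → Bool → V

/-- The least `n > 0` such that the `n`-th iterate of `f` sends `x` into the set `{x | p x}`. -/
noncomputable def returnTime {α : Type*} (f : Equiv.Perm α) (p : α → Prop) (x : α) : ℕ :=
  sInf {n : ℕ | 0 < n ∧ p ((f ^ n) x)}

theorem returnTime_mem {α : Type*} [Finite α] (f : Equiv.Perm α) (p : α → Prop) (x : α)
    (hx : p x) : 0 < returnTime f p x ∧ p ((f ^ returnTime f p x) x) := by
  have h : {n : ℕ | 0 < n ∧ p ((f ^ n) x)}.Nonempty :=
    ⟨orderOf f, orderOf_pos f, by simpa [pow_orderOf_eq_one] using hx⟩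
  exact Nat.sInf_mem h

theorem firstReturn_aux {α : Type*} [Finite α] (f : Equiv.Perm α) (p : α → Prop) (x y : α)
    (hx : p x)
    (h : (f ^ returnTime f p x) x = (f ^ returnTime f p y) y)
    (hle : returnTime f p x ≤ returnTime f p y) : x = y := by
  obtain ⟨k, hk⟩ := Nat.exists_eq_add_of_le hle
  have h1 : x = (f ^ k) y := by
    rw [hk, pow_add, Equiv.Perm.mul_apply] at h
    exact (f ^ returnTime f p x).injective h
  rcases Nat.eq_zero_or_pos k with h0 | h0
  · simpa [h0] using h1
  · have h2 : returnTime f p y ≤ k := Nat.sInf_le ⟨h0, h1 ▸ hx⟩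
    have h3 := (returnTime_mem f p x hx).1
    omega

/-- The permutation induced by `f` on the set `{x | p x}`, sending `x` to the first element
among `f x, f (f x), …` that satisfies `p`: each cycle of `f` that meets the set is shortened by
deleting its elements outside the set. -/
noncomputable def inducedPerm {α : Type*} [Finite α] (f : Equiv.Perm α) (p : α → Prop) :
    Equiv.Perm {x // p x} :=
  Equiv.ofBijective
    (fun x => ⟨(f ^ returnTime f p x.1) x.1, (returnTime_mem f p x.1 x.2).2⟩)
    (Finite.injective_iff_bijective.mp (by
      rintro ⟨x, hx⟩ ⟨y, hy⟩ h
      have h' := congrArg Subtype.val h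
      rcases le_total (returnTime f p x) (returnTime f p y) with hle | hle
      · exact Subtype.ext (firstReturn_aux f p x y hx h' hle)
      · exact Subtype.ext (firstReturn_aux f p y x hy h'.symm hle).symm))

namespace MultiGraph

variable {V E : Type*}

/-- The vertex to which a half edge is attached. -/
def vert (G : MultiGraph V E) (h : E × Bool) : V := G.ends h.1 h.2

/-- The fixed-point-free involution exchanging the two half edges of every edge. -/
def flip (_G : MultiGraph V E) : Equiv.Perm (E × Bool) :=
  Equiv.prodCongr (Equiv.refl E) Equiv.boolNot

/-- `G` is non-empty, and any two vertices are joined by a path. -/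
def Connected (G : MultiGraph V E) : Prop :=
  (SimpleGraph.fromRel fun x y : V => ∃ e : E, G.ends e false = x ∧ G.ends e true = y).Connected

/-- The set `H(v)` of the half edges around the vertex `v`. -/
abbrev HalfEdgesAt (G : MultiGraph V E) (v : V) : Type _ := {h : E × Bool // G.vert h = v}

/-- The degree of `v`; a loop at `v` counts twice. -/
noncomputable def degree (G : MultiGraph V E) (v : V) : ℕ := Nat.card (G.HalfEdgesAt v)

/-- The betti number of a connected graph. -/
noncomputable def betti (_G : MultiGraph V E) : ℤ := (Nat.card E : ℤ) - Nat.card V + 1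

/-- A `2`-cell embedding of `G` in a closed oriented surface, given combinatorially by its
rotation system: `rot` sends each half edge to the next one in the counterclockwise order around
its vertex, so that its cycles are exactly the sets of half edges at one vertex. -/
structure Embedding (G : MultiGraph V E) where
  rot : Equiv.Perm (E × Bool)
  sameCycle_iff : ∀ h k : E × Bool, rot.SameCycle h k ↔ G.vert h = G.vert k

namespace Embedding

variable {G : MultiGraph V E}

/-- The boundary permutation: from a half edge go to its counterclockwise neighbour,
and then to the other half of that edge. -/
def facePerm (M : G.Embedding) : Equiv.Perm (E × Bool) := G.flip * M.rot

/-- The faces: one for each cycle of the boundary permutation and, to cover the graph that has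
one vertex and no edge (embedded in the sphere), one for each vertex without half edges. -/
def Face (M : G.Embedding) : Type _ :=
  Quotient (Equiv.Perm.SameCycle.setoid M.facePerm) ⊕ {v : V // ∀ h, G.vert h ≠ v}

/-- The face `F` is incident to the vertex `v`: its boundary contains a half edge of `v`
(or `v` has no half edges and `F` is the face around it). -/
def Incident (M : G.Embedding) (F : M.Face) (v : V) : Prop :=
  match F with
  | Sum.inl c => ∃ h : E × Bool,
      Quotient.mk (Equiv.Perm.SameCycle.setoid M.facePerm) h = c ∧ G.vert h = v
  | Sum.inr w => w.1 = v

/-- The number of faces of the embedding. -/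
noncomputable def numFaces (M : G.Embedding) : ℕ := Nat.card M.Face

/-- The number `q` of faces incident to `v`. -/
noncomputable def numFacesAt (M : G.Embedding) (v : V) : ℕ :=
  Nat.card {F : M.Face // M.Incident F v}

/-- The genus `g` of an embedding of a connected graph, from Euler's formula
`|V| - |E| + f = 2 - 2 g`, that is `2 g = β(G) + 1 - f`. (The number `β(G) + 1 - f` is always
even, so the integer division is exact.) -/
noncomputable def genus (M : G.Embedding) : ℤ := (G.betti + 1 - M.numFaces) / 2

/-- The restriction `π_v` of the rotation to the half edges around `v`. -/
def rotAt (M : G.Embedding) (v : V) : Equiv.Perm (G.HalfEdgesAt v) :=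
  M.rot.subtypePerm fun h => by
    have : G.vert (M.rot h) = G.vert h :=
      (M.sameCycle_iff _ _).mp
        (Equiv.Perm.sameCycle_apply_left.mpr (Equiv.Perm.SameCycle.refl _ _))
    rw [this]

/-- The permutation `s_v` of the half edges around `v` whose cycles arise from the faces
incident to `v` by deleting all half edges that are not at `v`. -/
noncomputable def faceAt [Finite E] (M : G.Embedding) (v : V) :
    Equiv.Perm (G.HalfEdgesAt v) :=
  inducedPerm M.facePerm fun h => G.vert h = v

/-- The diagonal `D_v = s_v ∘ π_v⁻¹` of the vertex `v`. -/
noncomputable def diagonal [Finite E] (M : G.Embedding) (v : V) :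
    Equiv.Perm (G.HalfEdgesAt v) :=
  M.faceAt v * (M.rotAt v)⁻¹

/-- The number `ℓ(λ(D_v))` of parts of the cycle-type of `D_v`, where fixed points
count as cycles of length one. -/
noncomputable def diagonalLength [Fintype E] [DecidableEq E] [DecidableEq V]
    (M : G.Embedding) (v : V) : ℕ :=
  Multiset.card (M.diagonal v).partition.parts

/-- `M'` is obtained from `M` by rearranging the half edges around `v` only. -/
def IsReembeddingAt (M M' : G.Embedding) (v : V) : Prop :=
  ∀ h : E × Bool, G.vert h ≠ v → M'.rot h = M.rot h

end Embedding

/-- `G` is upper embeddable: the maximum genus of the embeddings of `G` equals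
`⌊β(G) / 2⌋`. -/
def UpperEmbeddable (G : MultiGraph V E) : Prop :=
  IsGreatest (Set.range fun M : G.Embedding => M.genus) (G.betti / 2)

end MultiGraph

/-! Replacing the rotation `π_v` by another full cycle `π` of `H(v)` multiplies the face permutation
on the right by `π_v⁻¹ π`, which moves only half edges at `v`. Faces avoiding `v` survive, and the
permutation induced on `H(v)` becomes `D_v π`, so the number of faces changes by the number of
cycles of `D_v π` minus `q` (`numFaces_reembed`). The question is thus which cycle counts occur
among the products of a fixed `D` with full cycles.

Signs fix the parity of the count. Joining the `ℓ` cycles of `D` by `ℓ - 1` transpositions yields a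
full cycle `π` for which `D π` has at least `n + 1 - ℓ` cycles, where `n` is the size of the set
(`exists_le_numCycles_mul`). While three cycles remain, two transpositions lower the count by two
and keep `π` a full cycle (`exists_numCycles_mul_add_two`). So every count from 1 to `n + 1 - ℓ` of
the right parity occurs, and Euler's formula turns counts into genera. If all faces meet `v`, one or
two faces can be reached, which is maximum genus. -/

namespace Equiv.Perm

/-! ### Cycle counts and signs. -/

variable {α : Type*}

/-- The number of cycles of a permutation, fixed points included. -/
noncomputable def numCycles (σ : Perm α) : ℕ := Nat.card (Quotient (SameCycle.setoid σ))

theorem SameCycle.eq_of_invariant {β : Type*} {σ : Perm α} {g : α → β}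
    (hg : ∀ x, g (σ x) = g x) {x y : α} (h : σ.SameCycle x y) : g x = g y := by
  obtain ⟨i, rfl⟩ := h
  have hpow : ∀ (n : ℕ) (z : α), g ((σ ^ n) z) = g z := by
    intro n
    induction n with
    | zero => intro z; rfl
    | succ n ih => intro z; rw [pow_succ, mul_apply, ih, hg]
  obtain ⟨n, rfl | rfl⟩ := i.eq_nat_or_neg
  · rw [zpow_natCast, hpow]
  · rw [zpow_neg, zpow_natCast]
    simpa using hpow n ((σ ^ n)⁻¹ x)

theorem card_partition_parts [Fintype α] [DecidableEq α] (σ : Perm α) :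
    Multiset.card σ.partition.parts = σ.numCycles := by
  classical
  have e : Quotient (SameCycle.setoid σ) ≃ {x // x ∉ σ.support} ⊕ σ.cycleFactorsFinset := by
    let f : α → {x // x ∉ σ.support} ⊕ σ.cycleFactorsFinset := fun x =>
      if hx : x ∈ σ.support then Sum.inr ⟨σ.cycleOf x, cycleOf_mem_cycleFactorsFinset_iff.mpr hx⟩
      else Sum.inl ⟨x, hx⟩
    have hf : ∀ x y, σ.SameCycle x y ↔ f x = f y := by
      intro x y
      by_cases hx : x ∈ σ.support <;> by_cases hy : y ∈ σ.support
      · simp only [f, hx, hy, dite_true, Sum.inr.injEq, Subtype.mk.injEq]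
        exact sameCycle_iff_cycleOf_eq_of_mem_support hx hy
      · simp only [f, hx, hy, dite_true, dite_false, reduceCtorEq, iff_false]
        intro h
        have hy' : Function.IsFixedPt σ y := notMem_support.mp hy
        exact hy ((h.eq_of_right hy') ▸ hx)
      · simp only [f, hx, hy, dite_true, dite_false, reduceCtorEq, iff_false]
        intro h
        have hx' : Function.IsFixedPt σ x := notMem_support.mp hx
        exact hx ((h.eq_of_left hx').symm ▸ hy)
      · simp only [f, hx, hy, dite_false, Sum.inl.injEq, Subtype.mk.injEq]
        have hx' : Function.IsFixedPt σ x := notMem_support.mp hx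
        exact ⟨fun h => h.eq_of_left hx', fun h => h ▸ SameCycle.refl _ _⟩
    refine Equiv.ofBijective (Quotient.lift f fun x y h => (hf x y).mp h) ⟨?_, ?_⟩
    · intro a b
      induction a using Quotient.inductionOn
      induction b using Quotient.inductionOn
      intro h
      exact Quotient.sound ((hf _ _).mpr h)
    · rintro (⟨x, hx⟩ | ⟨c, hc⟩)
      · exact ⟨Quotient.mk _ x, dif_neg hx⟩
      · obtain ⟨x, hx⟩ := (mem_cycleFactorsFinset_iff.mp hc).1.nonempty_support
        have hs := mem_cycleFactorsFinset_support_le hc hx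
        refine ⟨Quotient.mk _ x, ?_⟩
        simp only [Quotient.lift_mk, f, hs, dite_true]
        exact congrArg Sum.inr (Subtype.ext (cycle_is_cycleOf hx hc).symm)
  have h : Fintype.card {x // x ∉ σ.support} = Fintype.card α - σ.support.card := by
    rw [Fintype.card_subtype_compl, Fintype.card_coe]
  rw [numCycles, Nat.card_congr e, Nat.card_sum, Nat.card_eq_fintype_card, h,
    Nat.card_eq_fintype_card, Fintype.card_coe, parts_partition, Multiset.card_add,
    Multiset.card_replicate, cycleType_def, Multiset.card_map, Finset.card_val, add_comm]

theorem sign_eq_neg_one_pow [Fintype α] [DecidableEq α] (σ : Perm α) :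
    sign σ = (-1) ^ (Fintype.card α + σ.numCycles) := by
  rw [sign_of_cycleType, ← card_partition_parts, parts_partition, Multiset.card_add,
    Multiset.card_replicate, sum_cycleType]
  have h : σ.support.card ≤ Fintype.card α := Finset.card_le_univ _
  obtain ⟨k, hk⟩ := Nat.exists_eq_add_of_le h
  rw [hk, Nat.add_sub_cancel_left,
    show σ.support.card + k + (Multiset.card σ.cycleType + k)
      = σ.support.card + Multiset.card σ.cycleType + 2 * k by ring, pow_add _ _ (2 * k), pow_mul]
  simp

/-! ### Effect of a transposition on the number of cycles. -/

open Classical in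
/-- The cycle of `x`, where the cycles of `a` and `b` are identified. -/
noncomputable def mergedClass (σ : Perm α) (a b x : α) : Quotient (SameCycle.setoid σ) :=
  if σ.SameCycle b x then Quotient.mk _ a else Quotient.mk _ x

theorem mergedClass_apply (σ : Perm α) (a b x : α) :
    mergedClass σ a b (σ x) = mergedClass σ a b x := by
  have h : (Quotient.mk (SameCycle.setoid σ) (σ x)) = Quotient.mk _ x :=
    Quotient.sound (sameCycle_apply_left.mpr (SameCycle.refl σ x))
  unfold mergedClass
  split_ifs with h1 h2 h2
  · rfl
  · exact absurd (sameCycle_apply_right.mp h1) h2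
  · exact absurd (sameCycle_apply_right.mpr h2) h1
  · exact h

theorem mergedClass_left (σ : Perm α) (a b : α) : mergedClass σ a b a = Quotient.mk _ a := by
  simp [mergedClass]

theorem mergedClass_right (σ : Perm α) (a b : α) : mergedClass σ a b b = Quotient.mk _ a :=
  if_pos (SameCycle.refl σ b)

theorem mergedClass_swap [DecidableEq α] (σ : Perm α) (a b x : α) :
    mergedClass σ a b (swap a b x) = mergedClass σ a b x := by
  rcases eq_or_ne x a with rfl | ha
  · rw [swap_apply_left, mergedClass_left, mergedClass_right]
  rcases eq_or_ne x b with rfl | hb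
  · rw [swap_apply_right, mergedClass_left, mergedClass_right]
  rw [swap_apply_of_ne_of_ne ha hb]

/-- Universal property of the merged partition: it is the finest `σ`-invariant one that puts `a` and
`b` together. -/
theorem mergedClass_eq_of_eq {β : Type*} {σ : Perm α} {a b : α} {g : α → β}
    (hg : ∀ x, g (σ x) = g x) (hab : g a = g b) {x y : α}
    (h : mergedClass σ a b x = mergedClass σ a b y) : g x = g y := by
  have key : ∀ z w, Quotient.mk (SameCycle.setoid σ) z = Quotient.mk _ w → g z = g w :=
    fun z w h => (Quotient.exact h : σ.SameCycle z w).eq_of_invariant hg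
  have hb : ∀ z, σ.SameCycle b z → g a = g z := fun z h => hab.trans (h.eq_of_invariant hg)
  unfold mergedClass at h
  split_ifs at h with h1 h2 h2
  · rw [← hb x h1, ← hb y h2]
  · rw [← hb x h1, key _ _ h]
  · rw [← hb y h2, key _ _ h]
  · exact key _ _ h

theorem card_range_mergedClass_of_sameCycle {σ : Perm α} {a b : α} (h : σ.SameCycle a b) :
    Nat.card (Set.range (mergedClass σ a b)) = σ.numCycles := by
  have hs : Set.range (mergedClass σ a b) = _root_.Set.univ := by
    refine Set.eq_univ_of_forall fun c => ?_
    induction c using Quotient.inductionOn with | _ x =>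
    refine ⟨x, ?_⟩
    unfold mergedClass
    split_ifs with hx
    · exact Quotient.sound (h.trans hx)
    · rfl
  rw [hs, Nat.card_coe_set_eq, Set.ncard_univ, numCycles]

theorem card_range_mergedClass_of_not_sameCycle [Finite α] {σ : Perm α} {a b : α}
    (h : ¬ σ.SameCycle a b) :
    Nat.card (Set.range (mergedClass σ a b)) + 1 = σ.numCycles := by
  have hs : Set.range (mergedClass σ a b) = {Quotient.mk _ b}ᶜ := by
    ext c
    simp only [Set.mem_compl_iff, Set.mem_singleton_iff]
    constructor
    · rintro ⟨x, rfl⟩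
      unfold mergedClass
      split_ifs with hx
      · exact fun hc => h (Quotient.exact hc)
      · exact fun hc => hx (SameCycle.symm (Quotient.exact hc))
    · induction c using Quotient.inductionOn with | _ x =>
      intro hx
      refine ⟨x, ?_⟩
      unfold mergedClass
      rw [if_neg fun hb => hx (Quotient.sound hb.symm)]
  rw [hs, Nat.card_coe_set_eq, numCycles,
    ← Set.ncard_add_ncard_compl {Quotient.mk (SameCycle.setoid σ) b}, Set.ncard_singleton, add_comm]

/-- Once `a` and `b` are identified, `σ` and `σ * swap a b` generate the same partition; each merged
class map is invariant under the other permutation. -/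
theorem card_range_mergedClass_mul_swap [DecidableEq α] (σ : Perm α) (a b : α) :
    Nat.card (Set.range (mergedClass (σ * swap a b) a b)) =
      Nat.card (Set.range (mergedClass σ a b)) := by
  have hker : Setoid.ker (mergedClass (σ * swap a b) a b) = Setoid.ker (mergedClass σ a b) := by
    ext x y
    constructor <;> intro h
    · refine mergedClass_eq_of_eq (σ := σ * swap a b) (a := a) (b := b) (fun z => ?_) ?_ h
      · rw [mul_apply, mergedClass_apply, mergedClass_swap]
      · rw [mergedClass_left, mergedClass_right]
    · refine mergedClass_eq_of_eq (σ := σ) (a := a) (b := b) (fun z => ?_) ?_ h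
      · have := mergedClass_apply (σ * swap a b) a b (swap a b z)
        rwa [mul_apply, swap_apply_self, mergedClass_swap] at this
      · rw [mergedClass_left, mergedClass_right]
  rw [← Nat.card_congr (Setoid.quotientKerEquivRange _), hker,
    Nat.card_congr (Setoid.quotientKerEquivRange _)]

theorem even_add_of_neg_one_pow_eq {a b : ℕ} (h : (-1 : ℤˣ) ^ a = (-1) ^ b) : Even (a + b) := by
  rw [← neg_one_pow_eq_one_iff_even (R := ℤˣ) (by decide), pow_add, h, ← mul_pow]
  simp

theorem odd_numCycles_mul_swap [Finite α] [DecidableEq α] (σ : Perm α) {a b : α} (hab : a ≠ b) :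
    Odd (σ.numCycles + (σ * swap a b).numCycles) := by
  cases nonempty_fintype α
  have h : sign (σ * swap a b) = - sign σ := by rw [sign_mul, sign_swap hab, mul_neg_one]
  rw [sign_eq_neg_one_pow, sign_eq_neg_one_pow] at h
  by_contra hodd
  rw [Nat.not_odd_iff_even] at hodd
  rw [← mul_neg_one ((-1 : ℤˣ) ^ (Fintype.card α + σ.numCycles)), ← pow_succ] at h
  have h2 := even_add_of_neg_one_pow_eq h
  obtain ⟨k, hk⟩ := h2
  obtain ⟨l, hl⟩ := hodd
  omega

/-- Both permutations have the same number of merged classes, so if `a` and `b` stayed in different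
cycles the two cycle counts would agree, against the change of sign. -/
theorem numCycles_mul_swap_and_sameCycle [Finite α] [DecidableEq α] {σ : Perm α} {a b : α}
    (h : ¬ σ.SameCycle a b) :
    (σ * swap a b).numCycles + 1 = σ.numCycles ∧ (σ * swap a b).SameCycle a b := by
  have hab : a ≠ b := fun e => h (e ▸ SameCycle.refl _ _)
  have hodd := odd_numCycles_mul_swap σ hab
  have h1 := card_range_mergedClass_of_not_sameCycle h
  have h2 := card_range_mergedClass_mul_swap σ a b
  by_cases hs : (σ * swap a b).SameCycle a b
  · have h3 := card_range_mergedClass_of_sameCycle hs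
    exact ⟨by omega, hs⟩
  · have h3 := card_range_mergedClass_of_not_sameCycle hs
    rw [show (σ * swap a b).numCycles = σ.numCycles by omega] at hodd
    exact absurd ⟨_, rfl⟩ (Nat.not_even_iff_odd.mpr hodd)

theorem numCycles_mul_swap_of_not_sameCycle [Finite α] [DecidableEq α] {σ : Perm α} {a b : α}
    (h : ¬ σ.SameCycle a b) : (σ * swap a b).numCycles + 1 = σ.numCycles :=
  (numCycles_mul_swap_and_sameCycle h).1

theorem numCycles_mul_swap_of_sameCycle [Finite α] [DecidableEq α] {σ : Perm α} {a b : α}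
    (hab : a ≠ b) (h : σ.SameCycle a b) :
    (σ * swap a b).numCycles = σ.numCycles + 1 ∧ ¬ (σ * swap a b).SameCycle a b := by
  have hodd := odd_numCycles_mul_swap σ hab
  have h1 := card_range_mergedClass_of_sameCycle h
  have h2 := card_range_mergedClass_mul_swap σ a b
  by_cases hs : (σ * swap a b).SameCycle a b
  · have h3 := card_range_mergedClass_of_sameCycle hs
    rw [show (σ * swap a b).numCycles = σ.numCycles by omega] at hodd
    exact absurd ⟨_, rfl⟩ (Nat.not_even_iff_odd.mpr hodd)
  · have h3 := card_range_mergedClass_of_not_sameCycle hs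
    exact ⟨by omega, hs⟩

theorem numCycles_le_numCycles_mul_swap_add_one [Finite α] [DecidableEq α] (σ : Perm α) (a b : α) :
    σ.numCycles ≤ (σ * swap a b).numCycles + 1 := by
  by_cases h : σ.SameCycle a b
  · rcases eq_or_ne a b with rfl | hab
    · rw [swap_self]
      exact Nat.le_succ _
    · have := (numCycles_mul_swap_of_sameCycle hab h).1
      omega
  · exact (numCycles_mul_swap_of_not_sameCycle h).ge

theorem numCycles_conj (σ τ : Perm α) : (τ * σ * τ⁻¹).numCycles = σ.numCycles := by
  refine Nat.card_congr (Quotient.congr τ⁻¹ fun x y => ?_)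
  exact sameCycle_conj

theorem numCycles_inv (σ : Perm α) : σ⁻¹.numCycles = σ.numCycles :=
  Nat.card_congr (Quotient.congr (Equiv.refl α) fun _ _ => sameCycle_inv)

theorem numCycles_one : (1 : Perm α).numCycles = Nat.card α :=
  (Nat.card_eq_of_bijective (Quotient.mk _)
    ⟨fun _ _ h => sameCycle_one.mp (Quotient.exact h), Quotient.mk_surjective⟩).symm

/-! ### Products of a fixed permutation with full cycles. -/

theorem exists_numCycles_of_pairwise [Finite α] {σ : Perm α} {k : ℕ} (h : k ≤ σ.numCycles) :
    ∃ f : Fin k → α, ∀ i j, σ.SameCycle (f i) (f j) → i = j := by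
  have := Fintype.ofFinite (Quotient (SameCycle.setoid σ))
  rw [numCycles, Nat.card_eq_fintype_card, ← Fintype.card_fin k] at h
  obtain ⟨g⟩ := Function.Embedding.nonempty_of_card_le (α := Fin k) (by simpa using h)
  refine ⟨fun i => (g i).out, fun i j hij => g.injective ?_⟩
  rw [← Quotient.out_eq (g i), ← Quotient.out_eq (g j)]
  exact Quotient.sound hij

theorem sameCycle_of_numCycles_eq_one [Finite α] {σ : Perm α} (h : σ.numCycles = 1) (x y : α) :
    σ.SameCycle x y := by
  have := (Nat.card_eq_one_iff_unique.mp h).1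
  exact Quotient.exact (Subsingleton.elim (Quotient.mk (SameCycle.setoid σ) x) (Quotient.mk _ y))

/-- Starting from a full cycle `π`, the number of cycles of `D * π` can be lowered by two. -/
theorem exists_numCycles_mul_add_two [Finite α] {D π : Perm α} (hπ : π.numCycles = 1)
    (h : 3 ≤ (D * π).numCycles) :
    ∃ π' : Perm α, π'.numCycles = 1 ∧ (D * π').numCycles + 2 = (D * π).numCycles := by
  classical
  obtain ⟨f, hf⟩ := exists_numCycles_of_pairwise h
  set s := D * π with hs
  have hne : ∀ i j, i ≠ j → ¬ s.SameCycle (f i) (f j) := fun i j hij h => hij (hf i j h)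
  have h01 := hne 0 1 (by decide)
  have hab : f 0 ≠ f 1 := fun e => h01 (e ▸ SameCycle.refl _ _)
  obtain ⟨hp, hpn⟩ := numCycles_mul_swap_of_sameCycle hab
    (sameCycle_of_numCycles_eq_one hπ (f 0) (f 1))
  obtain ⟨hq, hqs⟩ := numCycles_mul_swap_and_sameCycle h01
  have hnot : ¬ (s * swap (f 0) (f 1)).SameCycle (f 0) (f 2) := by
    intro hc
    have hm : mergedClass s (f 0) (f 1) (f 0) = mergedClass s (f 0) (f 1) (f 2) := by
      refine hc.eq_of_invariant fun z => ?_
      rw [mul_apply, mergedClass_apply, mergedClass_swap]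
    rw [mergedClass_left, mergedClass, if_neg (hne 1 2 (by decide))] at hm
    exact hne 0 2 (by decide) (Quotient.exact hm)
  -- The first swap joins two cycles of `s` and splits `π` into one part containing `f 0` and one
  -- containing `f 1`. Take as `x` whichever of the two is not in the part of `f 2`: swapping `x`
  -- with `f 2` makes `π` a full cycle again and joins a third cycle of `s`.
  obtain ⟨x, hx, hx'⟩ : ∃ x, ¬ (π * swap (f 0) (f 1)).SameCycle x (f 2) ∧
      (s * swap (f 0) (f 1)).SameCycle (f 0) x := by
    by_cases h0 : (π * swap (f 0) (f 1)).SameCycle (f 0) (f 2)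
    · exact ⟨f 1, fun h1 => hpn (h0.trans h1.symm), hqs⟩
    · exact ⟨f 0, h0, SameCycle.refl _ _⟩
  refine ⟨π * swap (f 0) (f 1) * swap x (f 2), ?_, ?_⟩
  · have := numCycles_mul_swap_of_not_sameCycle hx
    omega
  · have := numCycles_mul_swap_of_not_sameCycle (fun h => hnot (hx'.trans h))
    rw [← mul_assoc, ← mul_assoc, ← hs]
    omega

/-- `τ` is a product of `k` transpositions, each joining two cycles of `D`; starting from the
identity, each costs `τ` at most one cycle. -/
theorem exists_numCycles_mul_eq_one [Finite α] (k : ℕ) (D : Perm α) (hD : D.numCycles = k + 1) :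
    ∃ τ : Perm α, (D * τ).numCycles = 1 ∧ Nat.card α ≤ τ.numCycles + k := by
  classical
  induction k generalizing D with
  | zero => exact ⟨1, by simpa using hD, by rw [numCycles_one, add_zero]⟩
  | succ k ih =>
    obtain ⟨f, hf⟩ := exists_numCycles_of_pairwise (σ := D) (k := 2) (by omega)
    have h01 : ¬ D.SameCycle (f 0) (f 1) := fun h => absurd (hf 0 1 h) (by decide)
    have h1 := numCycles_mul_swap_of_not_sameCycle h01
    obtain ⟨τ, hτ, hc⟩ := ih (D * swap (f 0) (f 1)) (by omega)
    refine ⟨swap (f 0) (f 1) * τ, by rwa [← mul_assoc], ?_⟩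
    -- The bound concerns multiplication on the right, the swap here is on the left; inversion
    -- exchanges the sides.
    have h2 := numCycles_le_numCycles_mul_swap_add_one τ⁻¹ (f 0) (f 1)
    rw [numCycles_inv, ← numCycles_inv (τ⁻¹ * _), mul_inv_rev, inv_inv, swap_inv] at h2
    omega

theorem numCycles_pos [Finite α] [Nonempty α] (σ : Perm α) : 0 < σ.numCycles :=
  haveI : Nonempty (Quotient (SameCycle.setoid σ)) := Nonempty.map (Quotient.mk _) ‹_›
  Nat.card_pos

theorem exists_le_numCycles_mul [Finite α] [Nonempty α] (D : Perm α) :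
    ∃ π : Perm α, π.numCycles = 1 ∧ Nat.card α + 1 ≤ (D * π).numCycles + D.numCycles := by
  obtain ⟨k, hk⟩ := Nat.exists_eq_add_of_le' (numCycles_pos D)
  obtain ⟨τ, hτ, hc⟩ := exists_numCycles_mul_eq_one k D hk
  -- With this choice `D * π = D * τ⁻¹ * D⁻¹` has as many cycles as `τ`.
  refine ⟨(D * τ)⁻¹, by rw [numCycles_inv, hτ], ?_⟩
  rw [mul_inv_rev, ← mul_assoc, numCycles_conj, numCycles_inv]
  omega

/-- Multiplicativity of the sign, read off from cycle counts. -/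
theorem even_card_add_numCycles [Finite α] (D π : Perm α) (hπ : π.numCycles = 1) :
    Even (Nat.card α + 1 + (D * π).numCycles + D.numCycles) := by
  classical
  cases nonempty_fintype α
  have h := sign_mul D π
  rw [sign_eq_neg_one_pow, sign_eq_neg_one_pow, sign_eq_neg_one_pow, hπ, ← pow_add] at h
  obtain ⟨k, hk⟩ := even_add_of_neg_one_pow_eq h
  rw [Nat.card_eq_fintype_card]
  exact ⟨k - Fintype.card α, by omega⟩

/-- The possible numbers of cycles of the products of `D` with full cycles. -/
theorem exists_numCycles_mul_eq [Finite α] [Nonempty α] (D : Perm α) {m : ℕ} (h1 : 1 ≤ m)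
    (h2 : m + D.numCycles ≤ Nat.card α + 1) (h3 : Even (Nat.card α + 1 + m + D.numCycles)) :
    ∃ π : Perm α, π.numCycles = 1 ∧ (D * π).numCycles = m := by
  have key : ∀ (k : ℕ) (π : Perm α), π.numCycles = 1 → (D * π).numCycles = m + 2 * k →
      ∃ π : Perm α, π.numCycles = 1 ∧ (D * π).numCycles = m := by
    intro k
    induction k with
    | zero => exact fun π hπ h => ⟨π, hπ, h⟩
    | succ k ih =>
      intro π hπ h
      obtain ⟨π', hπ', h'⟩ := exists_numCycles_mul_add_two hπ (by omega : 3 ≤ (D * π).numCycles)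
      exact ih π' hπ' (by omega)
  obtain ⟨π, hπ, hle⟩ := exists_le_numCycles_mul D
  obtain ⟨i, hi⟩ := even_card_add_numCycles D π hπ
  obtain ⟨j, hj⟩ := h3
  -- The count for this `π` is at least `m`, so `i - j` does not truncate and is half the surplus.
  exact key (i - j) π hπ (by omega)

end Equiv.Perm

/-! ### First-return permutations. -/

theorem returnTime_eq_of_forall_not {α : Type*} {f : Equiv.Perm α} {p : α → Prop} {x : α} {n : ℕ}
    (hn : 0 < n) (hp : p ((f ^ n) x)) (h : ∀ m, 0 < m → m < n → ¬ p ((f ^ m) x)) :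
    returnTime f p x = n :=
  le_antisymm (Nat.sInf_le ⟨hn, hp⟩)
    (le_csInf ⟨n, hn, hp⟩ fun m hm => not_lt.mp fun hlt => h m hm.1 hlt hm.2)

theorem not_of_lt_returnTime {α : Type*} {f : Equiv.Perm α} {p : α → Prop} {x : α} {m : ℕ}
    (hm : 0 < m) (h : m < returnTime f p x) : ¬ p ((f ^ m) x) :=
  fun hp => absurd h (not_lt.mpr (Nat.sInf_le ⟨hm, hp⟩))

theorem coe_inducedPerm_apply {α : Type*} [Finite α] (f : Equiv.Perm α) (p : α → Prop)
    (x : {x // p x}) : (inducedPerm f p x : α) = (f ^ returnTime f p x.1) x.1 := rfl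

/-- `ρ` acts once, at the start; until the next return the orbit lies outside the set and follows
`f`. -/
theorem inducedPerm_mul_ofSubtype {α : Type*} [Finite α] (f : Equiv.Perm α) (p : α → Prop)
    [DecidablePred p] (ρ : Equiv.Perm {x // p x}) :
    inducedPerm (f * Equiv.Perm.ofSubtype ρ) p = inducedPerm f p * ρ := by
  ext x
  obtain ⟨hpos, hmem⟩ := returnTime_mem f p (ρ x).1 (ρ x).2
  have hpow : ∀ m, m + 1 ≤ returnTime f p (ρ x) →
      ((f * Equiv.Perm.ofSubtype ρ) ^ (m + 1)) x.1 = (f ^ (m + 1)) (ρ x).1 := by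
    intro m
    induction m with
    | zero =>
      intro _
      rw [zero_add, pow_one, pow_one, Equiv.Perm.mul_apply, Equiv.Perm.ofSubtype_apply_coe]
    | succ m ih =>
      intro hm
      rw [pow_succ', Equiv.Perm.mul_apply, ih (by omega), Equiv.Perm.mul_apply,
        Equiv.Perm.ofSubtype_apply_of_not_mem _ (not_of_lt_returnTime (p := p) (Nat.succ_pos m) (by omega)),
        ← Equiv.Perm.mul_apply, ← pow_succ']
  obtain ⟨r, hr⟩ := Nat.exists_eq_add_of_le' hpos
  have hret : returnTime (f * Equiv.Perm.ofSubtype ρ) p x = returnTime f p (ρ x) := by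
    refine returnTime_eq_of_forall_not hpos ?_ fun m hm hlt => ?_
    · rw [hr, hpow r hr.ge, ← hr]
      exact hmem
    · obtain ⟨k, rfl⟩ := Nat.exists_eq_add_of_le' hm
      rw [hpow k hlt.le]
      exact not_of_lt_returnTime hm hlt
  rw [coe_inducedPerm_apply, hret, Equiv.Perm.mul_apply, coe_inducedPerm_apply, hr, hpow r hr.ge]

theorem sameCycle_inducedPerm_iff {α : Type*} [Finite α] (f : Equiv.Perm α) (p : α → Prop)
    (x y : {x // p x}) : (inducedPerm f p).SameCycle x y ↔ f.SameCycle x.1 y.1 := by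
  constructor
  · intro h
    refine Quotient.exact (s := Equiv.Perm.SameCycle.setoid f) (h.eq_of_invariant
      (g := fun z => Quotient.mk (Equiv.Perm.SameCycle.setoid f) z.1) fun z => Quotient.sound ?_)
    exact Equiv.Perm.SameCycle.symm ⟨returnTime f p z, by rw [zpow_natCast, coe_inducedPerm_apply]⟩
  · intro h
    obtain ⟨n, -, hn⟩ := h.exists_pow_eq'
    induction n using Nat.strong_induction_on generalizing x with
    | _ n ih =>
      obtain ⟨hpos, -⟩ := returnTime_mem f p x.1 x.2
      rcases Nat.eq_zero_or_pos n with rfl | h0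
      · rw [Subtype.ext (by simpa using hn : x.1 = y.1)]
      · have hle : returnTime f p x ≤ n := Nat.sInf_le ⟨h0, hn ▸ y.2⟩
        have hs : (f ^ (n - returnTime f p x)) (inducedPerm f p x).1 = y.1 := by
          rw [coe_inducedPerm_apply, ← Equiv.Perm.mul_apply, ← pow_add, Nat.sub_add_cancel hle, hn]
        exact Equiv.Perm.sameCycle_apply_left.mp
          (ih _ (Nat.sub_lt h0 hpos) _ ⟨(n - returnTime f p x : ℕ), by rwa [zpow_natCast]⟩ hs)

/-- A change of `f` on the set `{x | p x}` changes the numbers of cycles of `f` and of the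
induced permutation by the same amount. -/
theorem numCycles_mul_ofSubtype {α : Type*} [Finite α] (f : Equiv.Perm α) (p : α → Prop)
    [DecidablePred p] (ρ : Equiv.Perm {x // p x}) :
    (f * Equiv.Perm.ofSubtype ρ).numCycles + (inducedPerm f p).numCycles =
      f.numCycles + (inducedPerm f p * ρ).numCycles := by
  classical
  induction ρ using Equiv.Perm.swap_induction_on' with
  | one => simp
  | mul_swap ρ x y hxy ih =>
    -- Hence a swap of `x` and `y` splits a cycle in both permutations or merges two in both.
    have hiff := sameCycle_inducedPerm_iff (f * Equiv.Perm.ofSubtype ρ) p x y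
    rw [inducedPerm_mul_ofSubtype] at hiff
    rw [map_mul, Equiv.Perm.ofSubtype_swap_eq, ← mul_assoc, ← mul_assoc]
    by_cases h : (inducedPerm f p * ρ).SameCycle x y
    · have h1 := (Equiv.Perm.numCycles_mul_swap_of_sameCycle hxy h).1
      have h2 := (Equiv.Perm.numCycles_mul_swap_of_sameCycle
        (fun e => hxy (Subtype.ext e)) (hiff.mp h)).1
      omega
    · have h1 := Equiv.Perm.numCycles_mul_swap_of_not_sameCycle h
      have h2 := Equiv.Perm.numCycles_mul_swap_of_not_sameCycle (fun e => h (hiff.mpr e))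
      omega

/-! ### Parity and face counts of embeddings. -/

namespace MultiGraph

variable {V E : Type*} {G : MultiGraph V E}

theorem sign_flip [Fintype E] [DecidableEq E] :
    Equiv.Perm.sign G.flip = (-1) ^ Fintype.card E := by
  have h : G.flip = Equiv.prodCongrRight fun _ => Equiv.boolNot := rfl
  have hb : Equiv.Perm.sign Equiv.boolNot = -1 := by decide
  rw [h, Equiv.Perm.sign_prodCongrRight]
  simp [hb]

namespace Embedding

theorem vert_rot (M : G.Embedding) (h : E × Bool) : G.vert (M.rot h) = G.vert h :=
  (M.sameCycle_iff _ _).mp (Equiv.Perm.sameCycle_apply_left.mpr (Equiv.Perm.SameCycle.refl _ _))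

theorem coe_rotAt_apply (M : G.Embedding) {v : V} (h : G.HalfEdgesAt v) :
    (M.rotAt v h : E × Bool) = M.rot h := rfl

theorem sameCycle_rotAt [Finite E] (M : G.Embedding) {v : V} (h k : G.HalfEdgesAt v) :
    (M.rotAt v).SameCycle h k := by
  obtain ⟨n, -, hn⟩ := ((M.sameCycle_iff h k).mpr (h.2.trans k.2.symm)).exists_pow_eq'
  refine ⟨n, Subtype.ext ?_⟩
  rw [zpow_natCast, rotAt, Equiv.Perm.subtypePerm_pow]
  exact hn

theorem numCycles_rotAt [Finite E] (M : G.Embedding) {v : V} [Nonempty (G.HalfEdgesAt v)] :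
    (M.rotAt v).numCycles = 1 := by
  refine Nat.card_eq_one_iff_unique.mpr ⟨⟨fun a b => ?_⟩, Nonempty.map (Quotient.mk _) ‹_›⟩
  induction a using Quotient.inductionOn
  induction b using Quotient.inductionOn
  exact Quotient.sound (M.sameCycle_rotAt _ _)

theorem numFaces_eq [Finite V] [Finite E] (M : G.Embedding) :
    M.numFaces = M.facePerm.numCycles + Nat.card {v : V // ∀ h, G.vert h ≠ v} := by
  have : Finite (Quotient (Equiv.Perm.SameCycle.setoid M.facePerm)) := Quotient.finite _
  exact Nat.card_sum

theorem numCycles_rot [Finite V] [Finite E] (M : G.Embedding) :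
    M.rot.numCycles + Nat.card {v : V // ∀ h, G.vert h ≠ v} = Nat.card V := by
  have : Finite (Quotient (Equiv.Perm.SameCycle.setoid M.rot)) := Quotient.finite _
  rw [Equiv.Perm.numCycles, ← Nat.card_sum]
  refine Nat.card_eq_of_bijective (Sum.elim
    (Quotient.lift G.vert fun h k e => (M.sameCycle_iff h k).mp e) Subtype.val) ⟨?_, fun v => ?_⟩
  · refine Function.Injective.sumElim ?_ Subtype.val_injective ?_
    · intro a b
      induction a using Quotient.inductionOn
      induction b using Quotient.inductionOn
      exact fun h => Quotient.sound ((M.sameCycle_iff _ _).mpr h)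
    · intro a b
      induction a using Quotient.inductionOn
      exact b.2 _
  · by_cases h : ∃ h, G.vert h = v
    · obtain ⟨h, rfl⟩ := h
      exact ⟨Sum.inl (Quotient.mk _ h), rfl⟩
    · exact ⟨Sum.inr ⟨v, not_exists.mp h⟩, rfl⟩

/-- The Euler characteristic of an embedding is even. -/
theorem even_betti_add_one_sub_numFaces [Fintype V] [Fintype E] (M : G.Embedding) :
    Even (G.betti + 1 - M.numFaces) := by
  classical
  -- The parity comes from comparing signs; vertices without half edges enter `numFaces_eq` and
  -- `numCycles_rot` alike.
  have h : Equiv.Perm.sign M.facePerm = _ := Equiv.Perm.sign_mul G.flip M.rot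
  rw [sign_flip, Equiv.Perm.sign_eq_neg_one_pow, Equiv.Perm.sign_eq_neg_one_pow, ← pow_add] at h
  obtain ⟨k, hk⟩ := Equiv.Perm.even_add_of_neg_one_pow_eq h
  have h1 := M.numFaces_eq
  have h2 := M.numCycles_rot
  rw [Fintype.card_prod, Fintype.card_bool] at hk
  rw [betti, Nat.card_eq_fintype_card (α := E)]
  rw [Int.even_iff]
  omega

theorem numFaces_pos [Finite V] [Finite E] [Nonempty V] (M : G.Embedding) : 0 < M.numFaces := by
  have : Finite (Quotient (Equiv.Perm.SameCycle.setoid M.facePerm)) := Quotient.finite _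
  have : Finite M.Face := inferInstanceAs (Finite (_ ⊕ _))
  have : Nonempty M.Face := by
    obtain ⟨v⟩ := ‹Nonempty V›
    by_cases h : ∃ h, G.vert h = v
    · obtain ⟨h, -⟩ := h
      exact ⟨Sum.inl (Quotient.mk _ h)⟩
    · exact ⟨Sum.inr ⟨v, not_exists.mp h⟩⟩
  exact Nat.card_pos

theorem genus_le [Finite V] [Finite E] [Nonempty V] (M : G.Embedding) :
    M.genus ≤ G.betti / 2 := by
  have := M.numFaces_pos
  unfold genus
  omega

theorem numFacesAt_eq_numCycles_faceAt [Finite E] (M : G.Embedding) {v : V}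
    [Nonempty (G.HalfEdgesAt v)] : M.numFacesAt v = (M.faceAt v).numCycles := by
  have hiff : ∀ h k, (M.faceAt v).SameCycle h k ↔ M.facePerm.SameCycle h.1 k.1 :=
    sameCycle_inducedPerm_iff M.facePerm fun h => G.vert h = v
  refine (Nat.card_eq_of_bijective (Quotient.lift
    (fun h : G.HalfEdgesAt v => (⟨Sum.inl (Quotient.mk _ h.1), h.1, rfl, h.2⟩ :
      {F : M.Face // M.Incident F v}))
    fun h k e => Subtype.ext (congrArg Sum.inl (Quotient.sound ((hiff h k).mp e)))) ⟨?_, ?_⟩).symm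
  · intro a b
    induction a using Quotient.inductionOn
    induction b using Quotient.inductionOn
    intro h
    exact Quotient.sound ((hiff _ _).mpr
      (Quotient.exact (Sum.inl.inj (congrArg Subtype.val h))))
  · rintro ⟨c | w, hF⟩
    · obtain ⟨h, rfl, hv⟩ := hF
      exact ⟨Quotient.mk _ ⟨h, hv⟩, rfl⟩
    · obtain ⟨h⟩ := ‹Nonempty (G.HalfEdgesAt v)›
      exact absurd (h.2.trans (Eq.symm hF)) (w.2 h.1)

theorem numFacesAt_eq_one_of_isEmpty (M : G.Embedding) {v : V} (hv : ∀ h, G.vert h ≠ v) :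
    M.numFacesAt v = 1 := by
  refine Nat.card_eq_one_iff_unique.mpr ⟨⟨?_⟩, ⟨⟨Sum.inr ⟨v, hv⟩, rfl⟩⟩⟩
  have key : ∀ F : {F : M.Face // M.Incident F v}, F.1 = Sum.inr ⟨v, hv⟩ := by
    rintro ⟨c | w, hF⟩
    · obtain ⟨h, -, e⟩ := hF
      exact absurd e (hv h)
    · exact congrArg Sum.inr (Subtype.ext hF)
  exact fun F F' => Subtype.ext ((key F).trans (key F').symm)

/-! ### Changing the rotation at one vertex. -/

section Reembed

variable [DecidableEq V]

/-- The embedding obtained from `M` by taking the full cycle `π` as rotation around `v`. -/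
def reembed [Finite E] (M : G.Embedding) (v : V) (π : Equiv.Perm (G.HalfEdgesAt v))
    (hπ : ∀ h k, π.SameCycle h k) : G.Embedding where
  -- On `H(v)` the old rotation cancels and `π` remains; elsewhere the second factor is the
  -- identity.
  rot := M.rot * Equiv.Perm.ofSubtype ((M.rotAt v)⁻¹ * π)
  sameCycle_iff h k := by
    have hat : ∀ h : G.HalfEdgesAt v,
        (M.rot * Equiv.Perm.ofSubtype ((M.rotAt v)⁻¹ * π)) h.1 = (π h).1 := fun h => by
      rw [Equiv.Perm.mul_apply, Equiv.Perm.ofSubtype_apply_coe, ← coe_rotAt_apply,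
        ← Equiv.Perm.mul_apply, mul_inv_cancel_left]
    have hoff : ∀ h, G.vert h ≠ v →
        (M.rot * Equiv.Perm.ofSubtype ((M.rotAt v)⁻¹ * π)) h = M.rot h := fun h hv => by
      rw [Equiv.Perm.mul_apply, Equiv.Perm.ofSubtype_apply_of_not_mem (p := fun h => G.vert h = v) _ hv]
    constructor
    · refine fun e => e.eq_of_invariant fun x => ?_
      by_cases hx : G.vert x = v
      · exact (congrArg G.vert (hat ⟨x, hx⟩)).trans ((π ⟨x, hx⟩).2.trans hx.symm)
      · rw [hoff x hx, vert_rot]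
    · intro e
      by_cases hv : G.vert h = v
      · obtain ⟨n, -, hn⟩ := (hπ ⟨h, hv⟩ ⟨k, e ▸ hv⟩).exists_pow_eq'
        have hpow : ∀ n : ℕ, ((M.rot * Equiv.Perm.ofSubtype ((M.rotAt v)⁻¹ * π)) ^ n) h =
            ((π ^ n) ⟨h, hv⟩).1 := by
          intro n
          induction n with
          | zero => rfl
          | succ n ih => rw [pow_succ', Equiv.Perm.mul_apply, ih, hat, pow_succ',
              Equiv.Perm.mul_apply]
        exact ⟨n, by rw [zpow_natCast, hpow, hn]⟩
      · obtain ⟨n, -, hn⟩ := ((M.sameCycle_iff h k).mpr e).exists_pow_eq'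
        have hpow : ∀ n : ℕ, ((M.rot * Equiv.Perm.ofSubtype ((M.rotAt v)⁻¹ * π)) ^ n) h =
            (M.rot ^ n) h ∧ G.vert ((M.rot ^ n) h) = G.vert h := by
          intro n
          induction n with
          | zero => exact ⟨rfl, rfl⟩
          | succ n ih =>
            rw [pow_succ', Equiv.Perm.mul_apply, ih.1, hoff _ (ih.2 ▸ hv), pow_succ',
              Equiv.Perm.mul_apply, vert_rot]
            exact ⟨rfl, ih.2⟩
        exact ⟨n, by rw [zpow_natCast, (hpow n).1, hn]⟩

theorem isReembeddingAt_reembed [Finite E] (M : G.Embedding) (v : V)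
    (π : Equiv.Perm (G.HalfEdgesAt v)) (hπ : ∀ h k, π.SameCycle h k) :
    M.IsReembeddingAt (M.reembed v π hπ) v := fun h hv => by
  rw [reembed, Equiv.Perm.mul_apply, Equiv.Perm.ofSubtype_apply_of_not_mem (p := fun h => G.vert h = v) _ hv]

theorem numFaces_reembed [Finite V] [Finite E] (M : G.Embedding) (v : V)
    (π : Equiv.Perm (G.HalfEdgesAt v)) (hπ : ∀ h k, π.SameCycle h k) :
    (M.reembed v π hπ).numFaces + (M.faceAt v).numCycles =
      M.numFaces + (M.diagonal v * π).numCycles := by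
  have h := numCycles_mul_ofSubtype M.facePerm (fun h => G.vert h = v) ((M.rotAt v)⁻¹ * π)
  rw [← mul_assoc] at h
  change _ + (M.faceAt v).numCycles = _ + (M.diagonal v * π).numCycles at h
  rw [numFaces_eq, numFaces_eq]
  change (M.reembed v π hπ).facePerm.numCycles + _ = _ at h
  omega

theorem diagonalLength_le_degree [Fintype E] [DecidableEq E] (M : G.Embedding) (v : V) :
    M.diagonalLength v ≤ G.degree v := by
  rw [diagonalLength, Equiv.Perm.card_partition_parts]
  exact Nat.card_le_card_of_surjective _ Quotient.mk_surjective

theorem even_degree_add_numFacesAt_add_diagonalLength [Fintype E] [DecidableEq E]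
    (M : G.Embedding) (v : V) :
    Even (G.degree v + 1 + M.numFacesAt v + M.diagonalLength v) := by
  cases isEmpty_or_nonempty (G.HalfEdgesAt v) with
  | inl hempty =>
    have hd : G.degree v = 0 := Nat.card_of_isEmpty
    have hl := M.diagonalLength_le_degree v
    rw [M.numFacesAt_eq_one_of_isEmpty fun h e => hempty.false ⟨h, e⟩,
      Nat.eq_zero_of_le_zero (hl.trans hd.le), hd]
    decide
  | inr hne =>
    have hD : M.diagonal v * M.rotAt v = M.faceAt v := inv_mul_cancel_right _ _
    rw [diagonalLength, Equiv.Perm.card_partition_parts, numFacesAt_eq_numCycles_faceAt, ← hD]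
    exact Equiv.Perm.even_card_add_numCycles (M.diagonal v) (M.rotAt v) M.numCycles_rotAt

/-- Every number of faces in the admissible range arises by changing the rotation at `v`. -/
theorem exists_isReembeddingAt_numFaces_eq [Finite V] [Fintype E] [DecidableEq E] (M : G.Embedding)
    (v : V) {d : ℤ}
    (h1 : -(((G.degree v : ℤ) + 1 - M.diagonalLength v - M.numFacesAt v) / 2) ≤ d)
    (h2 : d ≤ ((M.numFacesAt v : ℤ) - 1) / 2) :
    ∃ M' : G.Embedding, M.IsReembeddingAt M' v ∧ (M'.numFaces : ℤ) = M.numFaces - 2 * d := by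
  have hl := M.diagonalLength_le_degree v
  rw [diagonalLength, Equiv.Perm.card_partition_parts] at h1
  cases isEmpty_or_nonempty (G.HalfEdgesAt v) with
  | inl hempty =>
    have hv : ∀ h, G.vert h ≠ v := fun h e => hempty.false ⟨h, e⟩
    have hq := M.numFacesAt_eq_one_of_isEmpty hv
    have hd : G.degree v = 0 := Nat.card_of_isEmpty
    rw [hq, hd] at h1
    rw [hq] at h2
    exact ⟨M, fun _ _ => rfl, by omega⟩
  | inr hne =>
    have hq := M.numFacesAt_eq_numCycles_faceAt (v := v)
    obtain ⟨k, hk⟩ := M.even_degree_add_numFacesAt_add_diagonalLength v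
    rw [diagonalLength, Equiv.Perm.card_partition_parts] at hk
    rw [degree] at h1 hk
    -- The required number of faces at `v`. The upper bound on `d` says `1 ≤ m`; the lower bound,
    -- with parity, says `m` is at most degree plus one minus the number of cycles of `D_v`.
    obtain ⟨m, hm⟩ : ∃ m : ℕ, (m : ℤ) = M.numFacesAt v - 2 * d :=
      ⟨_, Int.toNat_of_nonneg (by omega)⟩
    obtain ⟨π, hπ, hc⟩ := Equiv.Perm.exists_numCycles_mul_eq (M.diagonal v) (m := m)
      (by omega) (by omega) (by rw [Nat.even_iff]; omega)
    have hs := Equiv.Perm.sameCycle_of_numCycles_eq_one hπ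
    have hf := M.numFaces_reembed v π hs
    exact ⟨M.reembed v π hs, M.isReembeddingAt_reembed v π hs, by omega⟩

end Reembed

end Embedding

end MultiGraph

theorem corollary4p3 {V E : Type*} [Fintype V] [Fintype E] [DecidableEq V] [DecidableEq E]
    (G : MultiGraph V E) (hG : G.Connected) (M : G.Embedding) (v : V) :
    (∀ Δg : ℤ,
      -(((G.degree v : ℤ) + 1 - (M.diagonalLength v : ℤ) - (M.numFacesAt v : ℤ)) / 2) ≤ Δg →
      Δg ≤ ((M.numFacesAt v : ℤ) - 1) / 2 →
      ∃ M' : G.Embedding, M.IsReembeddingAt M' v ∧ M'.genus = M.genus + Δg) ∧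
    ((∀ F : M.Face, M.Incident F v) → G.UpperEmbeddable) := by
  refine ⟨fun Δg h1 h2 => ?_, fun hall => ?_⟩
  · obtain ⟨M', hM', hf⟩ := M.exists_isReembeddingAt_numFaces_eq v h1 h2
    refine ⟨M', hM', ?_⟩
    unfold MultiGraph.Embedding.genus
    omega
  · have : Nonempty V := hG.nonempty
    refine ⟨?_, by rintro _ ⟨M', rfl⟩; exact M'.genus_le⟩
    have hq : M.numFacesAt v = M.numFaces :=
      Nat.card_congr (Equiv.subtypeUnivEquiv hall)
    have hpos := M.numFaces_pos
    have hle := M.diagonalLength_le_degree v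
    obtain ⟨j, hj⟩ := M.even_degree_add_numFacesAt_add_diagonalLength v
    -- The largest admissible increase leaves one or two faces. It respects the lower bound because
    -- the numerator there is even and `D_v` has at most `deg v` cycles.
    obtain ⟨M', -, hf⟩ := M.exists_isReembeddingAt_numFaces_eq v 
      (d := ((M.numFacesAt v : ℤ) - 1) / 2) (by omega) le_rfl
    -- Parity makes the Betti number odd when two faces remain, so the genus is the floor in both
    -- cases.
    obtain ⟨k, hk⟩ := M.even_betti_add_one_sub_numFaces
    refine ⟨M', ?_⟩
    change M'.genus = _
    unfold MultiGraph.Embedding.genus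
    omega
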